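/- **Proposition (a negative-pedal porism).** Let $\mathcal T$ be a nondegenerate triangle in the Euclidean plane with circumcircle $\mathcal C$, and let $D$ be a point lying neither on a side line of $\mathcal T$ nor on $\mathcal C$. For a point $P\ne D$ let $\ell_P$ denote the perpendicular to $DP$ at $P$. Let $\mathcal T_D$ be the negative-pedal triangle of $\mathcal T$ (the triangle whose side lines are the lines $\ell_P$, $P$ running over the vertices of $\mathcal T$), and let $\mathcal C_D$ be its circumcircle. The pedal circle of a triangle is the circumcircle of the triangle formed by the orthogonal projections of $D$ onto its side lines. "The conic inscribed in $\mathcal T$ with focus $D$" is the nondegenerate conic with focus $D$ that has the three side lines of $\mathcal T$ as tangents (an asymptote counts as a tangent). The inside of a conic is the region, or for a hyperbola the two regions, that it bounds and that contain its foci. (1) Let $A\in\mathcal C$ be such that $\ell_A$ meets $\mathcal C_D$ in two distinct points $B',C'$. The circles of diameters $[B'D]$ and $[C'D]$ pass through $A$. Let $C$ and $B$, respectively, be their second intersections with $\mathcal C$ (the second intersection is $A$ itself if the circle is tangent to $\mathcal C$ at $A$). Then the lines $BC'$ and $CB'$ (to be read as $\ell_B$ if $B=C'$, and as $\ell_C$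 if $C=B'$) meet in exactly one point $A'$, and i) $A'$ lies on $\mathcal C_D$; ii) if $B\ne A$ and $C\ne A$, then $A',B',C'$ are the vertices of a nondegenerate triangle which shares with $\mathcal T_D$ the same circumcircle $\mathcal C_D$ and the same pedal circle $\mathcal C$ with respect to $D$. (2) If $A\in\mathcal C$ and $\ell_A$ does not meet $\mathcal C_D$ in two distinct points, then there is no triangle inscribed in $\mathcal C$ with a vertex at $A$ whose negative-pedal triangle with respect to $D$ has circumcircle $\mathcal C_D$. (3) There is exactly one conic $\gamma_D$ inscribed in $\mathcal T$ with focus $D$. For $A\in\mathcal C$, the line $\ell_A$ does not meet $\mathcal C_D$ in two distinct points if and only if $A$ lies inside or on $\gamma_D$; that is, if and only if $A$ lies on one of the closed (infertile) arcs, possibly reduced to a point, that $\gamma_D$ and its inside cut out of $\mathcal C$. -/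

import Mathlib

open scoped RealInnerProductSpace

namespace PedalPorism

/-- The Euclidean plane. -/
abbrev Plane : Type := EuclideanSpace ℝ (Fin 2)

/-- The perpendicular to the line `D A` erected at the point `A` (a line when `A ≠ D`). -/
noncomputable def perpLine (D A : Plane) : AffineSubspace ℝ Plane :=
  AffineSubspace.mk' A (Submodule.span ℝ {A -ᵥ D})ᗮ

/-- The line `P X`, for a point `P` on the circle of diameter `[X D]`. If `P = X`, two points do
not determine a line and the limiting position, the perpendicular to `D P` at `P`, is meant
(by Thales' theorem the line `P X` is this perpendicular also when `P ≠ X`). -/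
noncomputable def joinLine (D P X : Plane) : AffineSubspace ℝ Plane :=
  open Classical in if P = X then perpLine D P else line[ℝ, P, X]

/-- `T'` is the negative-pedal triangle of `T` with respect to `D`: for each `i`, the side line
of `T'` opposite to its `i`-th vertex (the line through the two other vertices) is the
perpendicular to `D Tᵢ` at the `i`-th vertex `Tᵢ` of `T`. -/
def IsNegativePedalTriangle (D : Plane) (T T' : Affine.Triangle ℝ Plane) : Prop :=
  ∀ i j, j ≠ i → T'.points j ∈ perpLine D (T.points i)

/-- The negative-pedal triangle exists when `D` is neither on the side lines of `T` nor on its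
circumcircle. -/
theorem exists_isNegativePedalTriangle (D : Plane) (T : Affine.Triangle ℝ Plane)
    (hside : ∀ i j, i ≠ j → D ∉ line[ℝ, T.points i, T.points j])
    (hcirc : D ∉ T.circumsphere) :
    ∃ T' : Affine.Triangle ℝ Plane, IsNegativePedalTriangle D T T' := by
  -- normals of the side lines
  have key : ∀ P Q : Plane, P ≠ Q → D ∉ line[ℝ, P, Q] →
      ∃ n : Plane, ⟪n, P - D⟫ = 1 ∧ ⟪n, Q - D⟫ = 1 := by
    intro P Q hPQ h
    have hdet : (P 0 - D 0) * (Q 1 - D 1) - (P 1 - D 1) * (Q 0 - D 0) ≠ 0 := by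
      intro h0
      apply h
      suffices hs : ∃ t : ℝ, AffineMap.lineMap P Q t = D by
        obtain ⟨t, ht⟩ := hs
        have := AffineMap.lineMap_mem_affineSpan_pair t P Q
        rwa [ht] at this
      by_cases hx : Q 0 - P 0 = 0
      · have hy : Q 1 - P 1 ≠ 0 := by
          intro hy
          apply hPQ
          ext i
          fin_cases i <;> simp <;> linarith
        refine ⟨(D 1 - P 1) / (Q 1 - P 1), ?_⟩
        have hk : (D 0 - P 0) * (Q 1 - P 1) = 0 := by
          linear_combination -h0 + (D 1 - P 1) * hx
        have hk' : D 0 - P 0 = 0 := by simpa [hy] using hk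
        ext i
        fin_cases i
        · simp [AffineMap.lineMap_apply, hx]; linarith
        · simp [AffineMap.lineMap_apply]; field_simp; ring
      · refine ⟨(D 0 - P 0) / (Q 0 - P 0), ?_⟩
        ext i
        fin_cases i
        · simp [AffineMap.lineMap_apply]; field_simp; ring
        · simp [AffineMap.lineMap_apply]; field_simp; linear_combination -h0
    obtain ⟨d, hd⟩ : ∃ d, d = (P 0 - D 0) * (Q 1 - D 1) - (P 1 - D 1) * (Q 0 - D 0) := ⟨_, rfl⟩
    rw [← hd] at hdet
    refine ⟨!₂[((Q 1 - D 1) - (P 1 - D 1)) / d, ((P 0 - D 0) - (Q 0 - D 0)) / d], ?_, ?_⟩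
    · simp [PiLp.inner_apply, Fin.sum_univ_two]; field_simp; linear_combination -hd
    · simp [PiLp.inner_apply, Fin.sum_univ_two]; field_simp; linear_combination -hd
  have hn : ∀ i : Fin 3, ∃ n : Plane, ∀ j, j ≠ i → ⟪n, T.points j - D⟫ = 1 := by
    have hp : ∀ i j : Fin 3, i ≠ j → T.points i ≠ T.points j := fun i j h e =>
      h (T.independent.injective e)
    intro i
    fin_cases i
    · obtain ⟨n, h1, h2⟩ := key _ _ (hp 1 2 (by decide)) (hside 1 2 (by decide))
      exact ⟨n, fun j hj => by fin_cases j <;> simp_all⟩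
    · obtain ⟨n, h1, h2⟩ := key _ _ (hp 0 2 (by decide)) (hside 0 2 (by decide))
      exact ⟨n, fun j hj => by fin_cases j <;> simp_all⟩
    · obtain ⟨n, h1, h2⟩ := key _ _ (hp 0 1 (by decide)) (hside 0 1 (by decide))
      exact ⟨n, fun j hj => by fin_cases j <;> simp_all⟩
  choose n hn using hn
  have hn' : ∀ i, ⟪n i, T.points i - D⟫ ≠ 1 := by
    intro i hi
    have htop : affineSpan ℝ (Set.range T.points) = ⊤ :=
      T.independent.affineSpan_eq_top_iff_card_eq_finrank_add_one.2 (by simp)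
    have hD : D ∈ affineSpan ℝ (Set.range T.points) := by rw [htop]; trivial
    obtain ⟨w, hw, hDw⟩ := eq_affineCombination_of_mem_affineSpan_of_fintype hD
    have h0 : ∑ j, w j • (T.points j - D) = 0 := by
      simp only [smul_sub, Finset.sum_sub_distrib, ← Finset.sum_smul, hw, one_smul]
      rw [Finset.affineCombination_eq_linear_combination _ _ _ hw] at hDw
      rw [← hDw, sub_self]
    have h1 : ⟪n i, ∑ j, w j • (T.points j - D)⟫ = 1 := by
      rw [inner_sum, ← hw]
      refine Finset.sum_congr rfl fun j _ => ?_
      rw [inner_smul_right]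
      by_cases hj : j = i
      · rw [hj, hi, mul_one]
      · rw [hn i j hj, mul_one]
    rw [h0, inner_zero_right] at h1
    exact zero_ne_one h1
  set O := T.circumsphere.center with hO
  set r := T.circumsphere.radius with hr
  set l : ℝ := r ^ 2 - ‖D - O‖ ^ 2 with hl
  have hl0 : l ≠ 0 := by
    intro h
    apply hcirc
    rw [EuclideanGeometry.mem_sphere, dist_eq_norm]
    have hr0 : 0 ≤ r := T.circumradius_nonneg
    exact (sq_eq_sq₀ (norm_nonneg _) hr0).1 (by linarith)
  have hP : ∀ i, ‖T.points i - D‖ ^ 2 - 2 * ⟪O - D, T.points i - D⟫ = l := by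
    intro i
    have h1 := EuclideanGeometry.mem_sphere.1 (T.mem_circumsphere i)
    rw [dist_eq_norm, ← hO, ← hr] at h1
    have h2 : T.points i - O = (T.points i - D) - (O - D) := by abel
    rw [hl, ← h1, h2, norm_sub_sq_real (T.points i - D) (O - D), norm_sub_rev D O,
      real_inner_comm (O - D) (T.points i - D)]
    ring
  let p : Fin 3 → Plane := fun i => D + l • n i + (2 : ℝ) • (O - D)
  have hp : ∀ i j, ⟪p j - T.points i, T.points i - D⟫ = l * (⟪n j, T.points i - D⟫ - 1) := by
    intro i j
    have h2 : p j - T.points i = l • n j + (2 : ℝ) • (O - D) - (T.points i - D) := by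
      simp only [p]; abel
    rw [h2, inner_sub_left, inner_add_left, inner_smul_left, inner_smul_left,
      real_inner_self_eq_norm_sq]
    simp only [conj_trivial]
    linear_combination -(hP i)
  have hind : AffineIndependent ℝ p := by
    rw [affineIndependent_iff]
    intro s w hw hs i hi
    have h1 : ⟪∑ j ∈ s, w j • p j, T.points i - D⟫ = 0 := by rw [hs, inner_zero_left]
    have h2 : ⟪∑ j ∈ s, w j • (p j - T.points i), T.points i - D⟫ = 0 := by
      simp only [smul_sub, Finset.sum_sub_distrib, ← Finset.sum_smul, hw, zero_smul, sub_zero]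
      exact h1
    rw [sum_inner, Finset.sum_eq_single i] at h2
    · rw [inner_smul_left, hp] at h2
      have := sub_ne_zero.2 (hn' i)
      simpa [hl0, this] using h2
    · intro j _ hj
      rw [inner_smul_left, hp, hn j i hj.symm]
      simp
    · exact fun h => absurd hi h
  refine ⟨⟨p, hind⟩, fun i j hj => ?_⟩
  rw [perpLine, AffineSubspace.mem_mk', Submodule.mem_orthogonal_singleton_iff_inner_left]
  show ⟪p j - T.points i, T.points i - D⟫ = 0
  rw [hp, hn j i hj.symm]
  simp

/-- `S` is the pedal circle of `T` with respect to `D`: the circumcircle of the triangle whose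
vertices are the orthogonal projections of `D` onto the side lines of `T`. -/
def IsPedalCircle (D : Plane) (T : Affine.Triangle ℝ Plane)
    (S : EuclideanGeometry.Sphere Plane) : Prop :=
  ∃ t : Affine.Triangle ℝ Plane,
    (∀ i, t.points i = (T.faceOpposite i).orthogonalProjectionSpan D) ∧ t.circumsphere = S

/-- A nondegenerate conic with a distinguished focus `F`, in focal form: the locus of the points
`X` with `|X F| = |p + ⟪w, X - F⟫|`, `p > 0`. For `w = 0` this is the circle with centre `F` and
radius `p`; for `w ≠ 0` it is the conic with focus `F`, directrix `p + ⟪w, X - F⟫ = 0` and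
eccentricity `‖w‖` (both branches, if it is a hyperbola). -/
structure FocalConic where
  focus : Plane
  w : Plane
  p : ℝ
  p_pos : 0 < p

namespace FocalConic

/-- The quadratic function whose zero set is the conic. -/
noncomputable def eqn (γ : FocalConic) (X : Plane) : ℝ :=
  dist X γ.focus ^ 2 - (γ.p + ⟪γ.w, X - γ.focus⟫) ^ 2

/-- The points of the conic. -/
def carrier (γ : FocalConic) : Set Plane := {X | γ.eqn X = 0}

/-- The inside of the conic: the region bounded by the conic that contains its foci (for a
hyperbola, the union of the two convex regions bounded by its branches). -/
def inside (γ : FocalConic) : Set Plane := {X | γ.eqn X < 0}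

/-- The line through the distinct points `P` and `Q` is a tangent of the conic: it meets the conic
in a double point, which may be at infinity (that is, an asymptote of a hyperbola is a tangent).
Along the line the equation of the conic is a polynomial `a t² + b t + c`, and this is
the vanishing of its discriminant. -/
def IsTangent (γ : FocalConic) (P Q : Plane) : Prop :=
  ∃ a b c : ℝ, (∀ t : ℝ, γ.eqn (AffineMap.lineMap P Q t) = a * t ^ 2 + b * t + c) ∧
    discrim a b c = 0

/-- The conic is inscribed in the triangle `T`: the three side lines of `T` are tangents. -/
def IsInscribedIn (γ : FocalConic) (T : Affine.Triangle ℝ Plane) : Prop :=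
  ∀ i j, i ≠ j → γ.IsTangent (T.points i) (T.points j)

end FocalConic

end PedalPorism

/-! Take the circumcircle of `T'` as the unit circle of ℂ, write `g` for `D`, and let `f` be the
reflection of `D` in the centre of the circumcircle of `T`. That circumcircle is the pedal circle of
the central conic with foci `f`, `g`, and the vertices of `T` are the feet of the perpendiculars
from `g` to the sides of `T'`. So `T'` is inscribed in the unit circle and circumscribed to this
conic, and the porism is Poncelet's theorem for triangles.

A chord `u v` is tangent to the conic iff `(u + v - f - u v f') (u + v - g - u v g') = 4 k u v`,
with primes for conjugates and `-k ≠ 0` the power of `g` (`onCircle_foot_iff`). If the three sides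
of a triangle are tangent, its vertices are the roots of `z (z - f) (z - g) = u v w (1 - f' z) (1 -
g' z)`, whose Vieta relations form `Closed`, and `4 k = (1 - f f') (1 - g g')`
(`power_eq_of_triangle`). This last equation does not mention the triangle, so it makes every
tangent chord close up (`exists_closed`). The two tangents from a vertex are the only ones
(`Closed.foot_cases`), which identifies the second intersections.

For the infertile arcs, polar reciprocity about `D` sends the side lines of `T` to the vertices of
`T'`, up to a homothety and a translation, and conics with focus `D` to circles. The inscribed conic
is therefore the dual of the circumcircle of `T'` (`isInscribedIn_iff`), and its equation at `A` has
the sign that decides whether the perpendicular at `A` cuts that circle. -/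

open scoped ComplexConjugate

namespace PedalPorism

/-! ### Algebra of chords of the unit circle tangent to a conic with given foci -/

section Algebra

variable {K : Type*} [Field K]

/-- The displacement `ξ` from `g` to its projection on the chord `u v` of the unit circle; primes
denote conjugates. -/
lemma foot_of_chord {u u' v v' g g' ξ ξ' : K} (hu : u * u' = 1) (hv : v * v' = 1) (huv : u ≠ v)
    (hξ : ξ' ≠ 0) (h1 : (u - g) * ξ' + (u' - g') * ξ = 2 * ξ * ξ')
    (h2 : (v - g) * ξ' + (v' - g') * ξ = 2 * ξ * ξ') :
    ξ = u * v * ξ' ∧ 2 * ξ = u + v - g - u * v * g' := by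
  have e : ξ = u * v * ξ' := by
    -- Subtracting the hypotheses cancels the quadratic term; then `u' = 1 / u` and `v' = 1 / v`.
    have : (u - v) * (ξ - u * v * ξ') = 0 := by
      linear_combination (-u * v) * (h1 - h2) + v * ξ * hu - u * ξ * hv
    exact sub_eq_zero.1 ((mul_eq_zero.1 this).resolve_left (sub_ne_zero.2 huv))
  refine ⟨e, mul_left_cancel₀ hξ ?_⟩
  linear_combination -h1 + (u' - g') * e + v * ξ' * hu

/-- The chord `u v` is a tangent of the conic with foci `f`, `g` and squared semi-axis `k`
if and only if the foot of the perpendicular from `g` lies on the pedal circle. -/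
lemma chord_of_foot {u v f f' g g' ξ ξ' k : K} (e : ξ = u * v * ξ')
    (hG : 2 * ξ = u + v - g - u * v * g')
    (h : 2 * ξ * ξ' = 2 * k + (f - g) * ξ' + (f' - g') * ξ) :
    (u + v - f - u * v * f') * (u + v - g - u * v * g') = 4 * k * (u * v) := by
  rw [← hG]
  linear_combination 2 * u * v * h + 2 * (2 * ξ - (f - g)) * e - 2 * ξ * hG

lemma foot_of_chord_eq {u v f f' g g' ξ ξ' k : K} (h2 : (2 : K) ≠ 0) (huv : u * v ≠ 0)
    (e : ξ = u * v * ξ') (hG : 2 * ξ = u + v - g - u * v * g')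
    (h : (u + v - f - u * v * f') * (u + v - g - u * v * g') = 4 * k * (u * v)) :
    2 * ξ * ξ' = 2 * k + (f - g) * ξ' + (f' - g') * ξ := by
  rw [← hG] at h
  refine mul_left_cancel₀ (mul_ne_zero h2 huv) ?_
  linear_combination h - 2 * (2 * ξ - (f - g)) * e + 2 * ξ * hG

/-- Two tangent chords through `u` determine the value at `u` of a Blaschke product. -/
lemma blaschke_of_chords {u v w f f' g g' k : K} (hvw : v ≠ w)
    (h1 : (u + v - f - u * v * f') * (u + v - g - u * v * g') = 4 * k * (u * v))
    (h2 : (u + w - f - u * w * f') * (u + w - g - u * w * g') = 4 * k * (u * w)) :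
    (u - f) * (u - g) = (1 - u * f') * (1 - u * g') * (v * w) := by
  -- For fixed `u` the chord equation is quadratic in the other end; its roots are `v` and `w`, and
  -- this is their product.
  have : (v - w) * ((1 - u * f') * (1 - u * g') * (v * w) - (u - f) * (u - g)) = 0 := by
    linear_combination w * h1 - v * h2
  exact (sub_eq_zero.1 ((mul_eq_zero.1 this).resolve_left (sub_ne_zero.2 hvw))).symm

/-- Multiplied by `u`, `v`, `w` respectively, the hypotheses say that one monic cubic vanishes at
three distinct points; a second divided difference extracts the sum of its roots. -/
lemma sum_of_blaschke {u v w f f' g g' : K} (huv : u ≠ v) (huw : u ≠ w) (hvw : v ≠ w)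
    (h1 : (u - f) * (u - g) = (1 - u * f') * (1 - u * g') * (v * w))
    (h2 : (v - f) * (v - g) = (1 - v * f') * (1 - v * g') * (u * w))
    (h3 : (w - f) * (w - g) = (1 - w * f') * (1 - w * g') * (u * v)) :
    u + v + w = f + g + f' * g' * (u * v * w) := by
  have : ((u - v) * (u - w) * (v - w)) * (u + v + w - (f + g + f' * g' * (u * v * w))) = 0 := by
    linear_combination (v - w) * u * h1 - (u - w) * v * h2 + (u - v) * w * h3
  exact sub_eq_zero.1 ((mul_eq_zero.1 this).resolve_left
    (mul_ne_zero (mul_ne_zero (sub_ne_zero.2 huv) (sub_ne_zero.2 huw)) (sub_ne_zero.2 hvw)))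

/-- The symmetric relation between the vertices of a triangle inscribed in the unit circle and
circumscribed to a conic with foci `f`, `g`, together with its conjugate. -/
structure Closed (f f' g g' u v w : K) : Prop where
  sum : u + v + w = f + g + f' * g' * (u * v * w)
  sum₂ : u * v + u * w + v * w = f * g + (f' + g') * (u * v * w)

lemma Closed.swap {f f' g g' u v w : K} (h : Closed f f' g g' u v w) :
    Closed f f' g g' u w v :=
  ⟨by linear_combination h.sum, by linear_combination h.sum₂⟩

lemma Closed.rotate {f f' g g' u v w : K} (h : Closed f f' g g' u v w) :
    Closed f f' g g' v w u :=
  ⟨by linear_combination h.sum, by linear_combination h.sum₂⟩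

/-- Both relations of `Closed` are linear in `w`, and this is the result of eliminating `w`. The
constant on the right is what `4 * k` has to be. -/
lemma Closed.chord {f f' g g' u v w : K} (h : Closed f f' g g' u v w) :
    (u + v - f - u * v * f') * (u + v - g - u * v * g')
      = (1 - f * f') * (1 - g * g') * (u * v) := by
  linear_combination (u + v - (u * v) * (f' + g')) * h.sum - (1 - f' * g' * (u * v)) * h.sum₂

lemma Closed.blaschke {f f' g g' u v w : K} (hu : u ≠ 0) (h : Closed f f' g g' u v w) :
    (u - f) * (u - g) = (1 - u * f') * (1 - u * g') * (v * w) := by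
  refine mul_left_cancel₀ hu ?_
  linear_combination u ^ 2 * h.sum - u * h.sum₂

/-- The two tangents through a vertex are the only ones. -/
lemma Closed.foot_cases {f f' g g' u u' v w k ξ ξ' : K}
    (hu : u * u' = 1) (h : Closed f f' g g' u v w) (hf : 1 - u * f' ≠ 0)
    (hk : 4 * k = (1 - f * f') * (1 - g * g'))
    (h1 : (u - g) * ξ' + (u' - g') * ξ = 2 * ξ * ξ')
    (hC : 2 * ξ * ξ' = 2 * k + (f - g) * ξ' + (f' - g') * ξ) :
    2 * ξ = u + v - g - u * v * g' ∨ 2 * ξ = u + w - g - u * w * g' := by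
  have hu0 : u ≠ 0 := left_ne_zero_of_mul_eq_one hu
  have hb := h.blaschke hu0
  -- The radical axis of the circle with diameter `u g` and the pedal circle.
  have e1 : (u - f) * ξ' * u + (1 - u * f') * ξ = 2 * k * u := by
    linear_combination u * h1 + u * hC - ξ * hu
  -- Eliminating `ξ'` with `e1` leaves a quadratic for the intersections of the two circles.
  have e2 : 2 * (2 * (1 - u * f') * ξ ^ 2
      - (4 * k * u + (u - g) * (1 - u * f') - (u - f) * (1 - u * g')) * ξ
      + 2 * k * u * (u - g)) = 0 := by
    linear_combination 2 * (u - f) * u * h1 - 2 * (u - f) * ξ * hu + (4 * ξ - 2 * (u - g)) * e1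
  have e3 : (1 - u * f') * ((2 * ξ - (u + v - g - u * v * g'))
      * (2 * ξ - (u + w - g - u * w * g'))) = 0 := by
    -- The claimed roots have the sum prescribed by `e2`; with `hb`, their product agrees too. No
    -- distinctness is needed, so tangent circles are covered.
    have hX : (1 - u * f') * (2 * (u - g) + (v + w) * (1 - u * g')) - 4 * k * u
        - (u - g) * (1 - u * f') + (u - f) * (1 - u * g') = 0 := by
      linear_combination (1 - u * f') * (1 - u * g') * h.sum - f' * g' * u * hb - u * hk
    linear_combination e2 - 2 * ξ * hX + (u - g) * hX - (1 - u * g') * hb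
  rcases mul_eq_zero.1 ((mul_eq_zero.1 e3).resolve_left hf) with h | h
  · exact Or.inl (sub_eq_zero.1 h)
  · exact Or.inr (sub_eq_zero.1 h)

end Algebra

/-! ### Feet of chords and the porism for the unit circle -/

/-- The point `x` lies on the perpendicular to `g a` at `a`. -/
def Perp (g a x : ℂ) : Prop :=
  (x - g) * conj (a - g) + conj (x - g) * (a - g) = 2 * (a - g) * conj (a - g)

/-- The point `a` lies on the circle with centre `(f + g) / 2` with respect to which `g` has
power `-k`. -/
def OnCircle (f g : ℂ) (k : ℝ) (a : ℂ) : Prop :=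
  2 * (a - g) * conj (a - g) = 2 * k + (f - g) * conj (a - g) + conj (f - g) * (a - g)

/-- The foot of the perpendicular from `g` to the line joining the points `u`, `v` of the unit
circle. -/
noncomputable def foot (g u v : ℂ) : ℂ := g + (u + v - g - u * v * conj g) / 2

lemma two_mul_foot_sub (g u v : ℂ) : 2 * (foot g u v - g) = u + v - g - u * v * conj g := by
  rw [foot]; ring

lemma foot_comm (g u v : ℂ) : foot g u v = foot g v u := by
  rw [foot, foot]; ring

/-- The numbers `z` with `z = u * v * conj z` form the real line perpendicular to the chord `u v`,
or to the tangent at `u` if `u = v`. -/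
lemma foot_sub_eq {g u v : ℂ} (hu : u * conj u = 1) (hv : v * conj v = 1) :
    foot g u v - g = u * v * conj (foot g u v - g) := by
  have h := two_mul_foot_sub g u v
  have h' := congrArg conj h
  simp only [map_mul, map_sub, map_add, Complex.conj_conj, map_ofNat] at h' ⊢
  linear_combination h / 2 - u * v / 2 * h' - v / 2 * hu - u / 2 * hv
    + g / 2 * (u * conj u * hv + hu)

lemma perp_foot {g u v : ℂ} (hu : u * conj u = 1) (hv : v * conj v = 1) :
    Perp g (foot g u v) u := by
  have h := two_mul_foot_sub g u v
  have e := foot_sub_eq (g := g) hu hv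
  rw [Perp]
  simp only [map_sub] at e ⊢
  linear_combination (-(conj (foot g u v) - conj g)) * h + (conj u - conj g) * e
    + v * (conj (foot g u v) - conj g) * hu

lemma OnCircle.ne {f g a : ℂ} {k : ℝ} (hk : k ≠ 0) (h : OnCircle f g k a) : a ≠ g := by
  rintro rfl
  simp [OnCircle] at h
  exact hk h

lemma conj_sub_ne {a g : ℂ} (h : a ≠ g) : conj (a - g) ≠ 0 :=
  (map_ne_zero _).2 (sub_ne_zero.2 h)

lemma eq_foot {g a u v : ℂ} (hu : u * conj u = 1) (hv : v * conj v = 1) (huv : u ≠ v)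
    (ha : a ≠ g) (h1 : Perp g a u) (h2 : Perp g a v) : a = foot g u v := by
  rw [Perp, map_sub conj u] at h1
  rw [Perp, map_sub conj v] at h2
  have h := (foot_of_chord hu hv huv (conj_sub_ne ha) h1 h2).2
  rw [foot]
  linear_combination h / 2

lemma mul_ne_zero_of_unit {u v : ℂ} (hu : u * conj u = 1) (hv : v * conj v = 1) : u * v ≠ 0 :=
  mul_ne_zero (left_ne_zero_of_mul_eq_one hu) (left_ne_zero_of_mul_eq_one hv)

lemma onCircle_foot_iff {f g u v : ℂ} {k : ℝ} (hu : u * conj u = 1) (hv : v * conj v = 1) :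
    OnCircle f g k (foot g u v) ↔
      (u + v - f - u * v * conj f) * (u + v - g - u * v * conj g) = 4 * k * (u * v) := by
  rw [OnCircle, map_sub conj f]
  exact ⟨chord_of_foot (foot_sub_eq hu hv) (two_mul_foot_sub g u v),
    foot_of_chord_eq two_ne_zero (mul_ne_zero_of_unit hu hv) (foot_sub_eq hu hv)
      (two_mul_foot_sub g u v)⟩

/-- Two different chords have different feet, unless `g` is their intersection. -/
lemma foot_ne {g u v w : ℂ} (hu : u * conj u = 1) (hug : u ≠ g) (hvw : v ≠ w) :
    foot g u v ≠ foot g u w := by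
  intro h
  have h1 : (v - w) * (u * (conj u - conj g)) = 0 := by
    linear_combination two_mul_foot_sub g u w - two_mul_foot_sub g u v + 2 * h + (v - w) * hu
  have h2 := (mul_eq_zero.1 h1).resolve_left (sub_ne_zero.2 hvw)
  have h3 := (mul_eq_zero.1 h2).resolve_left (left_ne_zero_of_mul_eq_one hu)
  rw [← map_sub] at h3
  exact conj_sub_ne hug h3

/-- The perpendiculars at the feet of the chords `w u` and `w v` only meet in `w`. -/
lemma eq_of_perp_foot {f g u v w x : ℂ} {k : ℝ} (hk : k ≠ 0) (hu : u * conj u = 1)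
    (hv : v * conj v = 1) (hw : w * conj w = 1) (huv : u ≠ v)
    (hb : OnCircle f g k (foot g w v)) (hc : OnCircle f g k (foot g w u))
    (h1 : Perp g (foot g w v) x) (h2 : Perp g (foot g w u) x) : x = w := by
  -- `x - w` is orthogonal to the vector from `g` to the foot, whose direction is given by
  -- `foot_sub_eq`. That vector can be cancelled because `g` is not on the circle.
  have key : ∀ z : ℂ, z * conj z = 1 → OnCircle f g k (foot g w z) → Perp g (foot g w z) x →
      (x - w) + (conj x - conj w) * (w * z) = 0 := by
    intro z hz hC hP
    have e := foot_sub_eq (g := g) hw hz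
    have hP' := perp_foot (g := g) hw hz
    have h0 := conj_sub_ne (hC.ne hk)
    rw [Perp, map_sub conj x] at hP
    rw [Perp, map_sub conj w] at hP'
    refine mul_left_cancel₀ h0 ?_
    linear_combination hP - hP' - (conj x - conj w) * e
  have h3 := key v hv hb h1
  have h4 := key u hu hc h2
  have h5 : (v - u) * (w * (conj x - conj w)) = 0 := by linear_combination h3 - h4
  have h6 := (mul_eq_zero.1 h5).resolve_left (sub_ne_zero.2 huv.symm)
  have h7 := (mul_eq_zero.1 h6).resolve_left (left_ne_zero_of_mul_eq_one hw)
  linear_combination h3 - w * v * h7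

lemma ne_of_closed {g f u : ℂ} {k : ℝ} (hk : k ≠ 0)
    (hK : 4 * (k : ℂ) = (1 - f * conj f) * (1 - g * conj g)) (hu : u * conj u = 1) :
    u ≠ f ∧ u ≠ g := by
  have hk' : (k : ℂ) ≠ 0 := by exact_mod_cast hk
  constructor <;> rintro rfl <;> rw [hu] at hK <;> simp [hk'] at hK

lemma one_sub_mul_conj_ne {u f : ℂ} (hu : u * conj u = 1) (h : u ≠ f) : 1 - u * conj f ≠ 0 := by
  intro h0
  have h1 : u * conj (u - f) = 0 := by rw [map_sub]; linear_combination h0 + hu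
  exact conj_sub_ne h ((mul_eq_zero.1 h1).resolve_left (left_ne_zero_of_mul_eq_one hu))

/-- The relation between the two circles and the point `g` for which a triangle exists. -/
lemma power_eq_of_triangle {f g u v w a b c : ℂ} {k : ℝ} (hk : k ≠ 0) (hu : u * conj u = 1)
    (hv : v * conj v = 1) (hw : w * conj w = 1) (huv : u ≠ v) (huw : u ≠ w) (hvw : v ≠ w)
    (ha : OnCircle f g k a) (hb : OnCircle f g k b) (hc : OnCircle f g k c)
    (hav : Perp g a v) (haw : Perp g a w) (hbu : Perp g b u) (hbw : Perp g b w)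
    (hcu : Perp g c u) (hcv : Perp g c v) :
    4 * (k : ℂ) = (1 - f * conj f) * (1 - g * conj g) := by
  rw [eq_foot hv hw hvw (ha.ne hk) hav haw, onCircle_foot_iff hv hw] at ha
  rw [eq_foot hu hw huw (hb.ne hk) hbu hbw, onCircle_foot_iff hu hw] at hb
  rw [eq_foot hu hv huv (hc.ne hk) hcu hcv, onCircle_foot_iff hu hv] at hc
  have h1 := blaschke_of_chords hvw hc hb
  have h2 := blaschke_of_chords (u := v) (v := u) (w := w) (f := f) (g := g) (k := k)
    (f' := conj f) (g' := conj g) huw (by linear_combination hc) ha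
  have h3 := blaschke_of_chords (u := w) (v := u) (w := v) (f := f) (g := g) (k := k)
    (f' := conj f) (g' := conj g) huv (by linear_combination hb) (by linear_combination ha)
  have hs := sum_of_blaschke huv huw hvw h1 h2 h3
  have hcl : Closed f (conj f) g (conj g) u v w := ⟨hs, by
    refine mul_left_cancel₀ (left_ne_zero_of_mul_eq_one hu) ?_
    linear_combination u ^ 2 * hs - h1 * u⟩
  refine mul_right_cancel₀ (mul_ne_zero_of_unit hu hv) ?_
  rw [← hcl.chord, hc]

/-- The third vertex: every tangent chord is a side of a triangle. -/
lemma exists_closed {f g u v : ℂ} {k : ℝ} (hk : k ≠ 0)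
    (hK : 4 * (k : ℂ) = (1 - f * conj f) * (1 - g * conj g))
    (hu : u * conj u = 1) (hv : v * conj v = 1)
    (h : OnCircle f g k (foot g u v)) :
    ∃ w : ℂ, w * conj w = 1 ∧ Closed f (conj f) g (conj g) u v w := by
  rw [onCircle_foot_iff hu hv, hK] at h
  -- The compatibility condition of the two equations of `Closed`, read as linear equations for the
  -- unknown `w` and its inverse.
  have h1 : (f + g - (u + v)) * (u * v * (conj f + conj g) - (u + v))
      = (1 - conj f * conj g * (u * v)) * (u * v - f * g) := by
    linear_combination h
  -- Otherwise `u`, `v` and `f`, `g` have the same sum and product, which puts a focus on the unit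
  -- circle, against `k ≠ 0`.
  have hN : 1 - conj f * conj g * (u * v) ≠ 0 := by
    intro hN
    have hN' := congrArg conj hN
    simp only [map_sub, map_mul, map_one, map_zero, Complex.conj_conj] at hN'
    have h2 : f * g = u * v := by
      linear_combination (-(u * v)) * hN' - f * g * (u * conj u * hv + hu)
    have h3 : f + g = u + v := by
      rw [hN, zero_mul] at h1
      rcases mul_eq_zero.1 h1 with h3 | h3
      · exact sub_eq_zero.1 h3
      · have h4 := congrArg conj h3
        simp only [map_sub, map_mul, map_add, map_zero, Complex.conj_conj] at h4
        linear_combination (u * v) * h4 - (f + g) * (u * conj u * hv + hu) + v * hu + u * hv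
    have h4 : (u - f) * (u - g) = 0 := by linear_combination h2 - u * h3
    obtain ⟨hf, hg⟩ := ne_of_closed hk hK hu
    rcases mul_eq_zero.1 h4 with h5 | h5
    · exact hf (sub_eq_zero.1 h5)
    · exact hg (sub_eq_zero.1 h5)
  have hN2 : u * v - f * g ≠ 0 := by
    intro h0
    apply hN
    have h0' := congrArg conj h0
    simp only [map_sub, map_mul, map_zero] at h0'
    linear_combination u * v * h0' - (u * conj u * hv + hu)
  obtain ⟨w, hw⟩ : ∃ w : ℂ, w * (1 - conj f * conj g * (u * v)) = f + g - (u + v) :=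
    ⟨_, div_mul_cancel₀ _ hN⟩
  have hw' := congrArg conj hw
  simp only [map_sub, map_mul, map_add, map_one, Complex.conj_conj] at hw'
  have hw'' : conj w * (u * v - f * g) = u * v * (conj f + conj g) - (u + v) := by
    linear_combination u * v * hw' + (conj w * f * g) * (u * conj u * hv + hu) - v * hu - u * hv
  -- `w` and `conj w` solve the two linear equations, so `h1` says that their product is `1`.
  have hw1 : w * conj w = 1 := by
    refine mul_left_cancel₀ (mul_ne_zero hN hN2) ?_
    linear_combination (conj w * (u * v - f * g)) * hw + (f + g - (u + v)) * hw'' + h1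
  refine ⟨w, hw1, ?_, ?_⟩
  · linear_combination hw
  · linear_combination w * hw'' - (u * v - f * g) * hw1

/-- The porism, for the unit circle. -/
theorem porism_unit_circle {f g u v a : ℂ} {k : ℝ} (hk : k ≠ 0)
    (hK : 4 * (k : ℂ) = (1 - f * conj f) * (1 - g * conj g))
    (hu : u * conj u = 1) (hv : v * conj v = 1) (huv : u ≠ v)
    (ha : OnCircle f g k a) (hau : Perp g a u) (hav : Perp g a v) :
    ∃ w b c : ℂ, w * conj w = 1 ∧ OnCircle f g k b ∧ OnCircle f g k c ∧ b ≠ c ∧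
      Perp g b v ∧ Perp g b w ∧ Perp g c u ∧ Perp g c w ∧
      (∀ x, OnCircle f g k x → Perp g x u → x = a ∨ x = c) ∧
      (∀ x, OnCircle f g k x → Perp g x v → x = a ∨ x = b) ∧
      (∀ x, Perp g b x → Perp g c x → x = w) ∧ (b ≠ a → w ≠ u) ∧ (c ≠ a → w ≠ v) := by
  obtain rfl := eq_foot hu hv huv (ha.ne hk) hau hav
  obtain ⟨w, hw, h⟩ := exists_closed hk hK hu hv ha
  have hne := fun z (hz : z * conj z = 1) => ne_of_closed hk hK hz
  have hb : OnCircle f g k (foot g w v) := by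
    rw [onCircle_foot_iff hw hv, hK]
    exact h.rotate.rotate.swap.chord
  have hc : OnCircle f g k (foot g w u) := by
    rw [onCircle_foot_iff hw hu, hK]
    exact h.rotate.rotate.chord
  have cases : ∀ p q r : ℂ, p * conj p = 1 → Closed f (conj f) g (conj g) p q r →
      ∀ x, OnCircle f g k x → Perp g x p → x = foot g p q ∨ x = foot g p r := by
    intro p q r hp hcl x hx hxp
    rw [Perp, map_sub conj p] at hxp
    rw [OnCircle, map_sub conj f] at hx
    refine (hcl.foot_cases hp (one_sub_mul_conj_ne hp (hne p hp).1) hK hxp hx).imp ?_ ?_ <;>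
    · intro e
      rw [foot]
      linear_combination e / 2
  -- `w` may coincide with `u` or `v`; the chord is then a tangent of the unit circle and `foot`
  -- still has a meaning. The two new feet differ in any case, since `u ≠ v`.
  refine ⟨w, foot g w v, foot g w u, hw, hb, hc, foot_ne hw (hne w hw).2 huv.symm, ?_,
    perp_foot hw hv, ?_, perp_foot hw hu, ?_, ?_,
    fun x => eq_of_perp_foot hk hu hv hw huv hb hc, ?_, ?_⟩
  · rw [foot_comm]; exact perp_foot hv hw
  · rw [foot_comm]; exact perp_foot hu hw
  · rw [foot_comm g w u]; exact cases u v w hu h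
  · rw [foot_comm g w v, foot_comm g u v]; exact cases v u w hv h.rotate.swap
  · rintro hba rfl; exact hba rfl
  · rintro hca rfl; exact hca (foot_comm _ _ _)

/-! ### Passage between the Euclidean plane and the complex coordinate -/

/-- The complex coordinate in which the circle with centre `M` and radius `R` is the unit circle. -/
noncomputable def toComplex (M : Plane) (R : ℝ) (X : Plane) : ℂ :=
  ⟨(X 0 - M 0) / R, (X 1 - M 1) / R⟩

lemma toComplex_injective {M : Plane} {R : ℝ} (hR : R ≠ 0) :
    Function.Injective (toComplex M R) := by
  intro X Y h
  rw [toComplex, toComplex, Complex.mk.injEq, div_left_inj' hR, div_left_inj' hR] at h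
  ext i
  fin_cases i
  · simpa using h.1
  · simpa using h.2

lemma toComplex_surjective {M : Plane} {R : ℝ} (hR : R ≠ 0) :
    Function.Surjective (toComplex M R) := by
  intro z
  refine ⟨!₂[M 0 + R * z.re, M 1 + R * z.im], ?_⟩
  apply Complex.ext <;> simp [toComplex, hR]

lemma inner_eq (X Y : Plane) : ⟪X, Y⟫ = X 0 * Y 0 + X 1 * Y 1 := by
  simp [PiLp.inner_apply, Fin.sum_univ_two, mul_comm]

lemma norm_sq_eq (X : Plane) : ‖X‖ ^ 2 = X 0 ^ 2 + X 1 ^ 2 := by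
  rw [← real_inner_self_eq_norm_sq, inner_eq]; ring

lemma dist_sq_eq (X Y : Plane) : dist X Y ^ 2 = (X 0 - Y 0) ^ 2 + (X 1 - Y 1) ^ 2 := by
  rw [dist_eq_norm, norm_sq_eq]; simp

lemma mem_perpLine {D A X : Plane} :
    X ∈ perpLine D A ↔ (X 0 - A 0) * (A 0 - D 0) + (X 1 - A 1) * (A 1 - D 1) = 0 := by
  rw [perpLine, AffineSubspace.mem_mk', Submodule.mem_orthogonal_singleton_iff_inner_left,
    inner_eq]
  simp

lemma mem_sphere_iff {S : EuclideanGeometry.Sphere Plane} (hS : 0 ≤ S.radius) {X : Plane} :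
    X ∈ S ↔ (X 0 - S.center 0) ^ 2 + (X 1 - S.center 1) ^ 2 = S.radius ^ 2 := by
  rw [EuclideanGeometry.mem_sphere, ← sq_eq_sq₀ dist_nonneg hS, dist_sq_eq]

lemma perp_toComplex {M : Plane} {R : ℝ} (hR : R ≠ 0) {D A X : Plane} :
    Perp (toComplex M R D) (toComplex M R A) (toComplex M R X) ↔ X ∈ perpLine D A := by
  rw [mem_perpLine, Perp, Complex.ext_iff]
  simp [toComplex]
  field_simp
  constructor
  · rintro ⟨h, -⟩; linear_combination h / 2
  · intro h; constructor
    · linear_combination 2 * h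
    · ring

lemma mem_ofDiameter {D A X : Plane} :
    A ∈ EuclideanGeometry.Sphere.ofDiameter X D ↔ X ∈ perpLine D A := by
  rw [← EuclideanGeometry.Sphere.angle_eq_pi_div_two_iff_mem_sphere_ofDiameter, EuclideanGeometry.angle,
    ← InnerProductGeometry.inner_eq_zero_iff_angle_eq_pi_div_two, mem_perpLine, inner_eq]
  simp only [vsub_eq_sub, PiLp.sub_apply]
  constructor <;> intro h <;> linear_combination -h

lemma mem_sphere_iff_toComplex {S : EuclideanGeometry.Sphere Plane} (hS : 0 < S.radius) {X : Plane} :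
    X ∈ S ↔ toComplex S.center S.radius X * conj (toComplex S.center S.radius X) = 1 := by
  rw [mem_sphere_iff hS.le, Complex.ext_iff]
  have := hS.ne'
  simp [toComplex]
  field_simp
  constructor
  · intro h; constructor
    · linear_combination h
    · ring
  · rintro ⟨h, -⟩; linear_combination h

/-- In the normalized coordinate, `S` has its centre at the midpoint of `D` and of the reflection of
`D` in the centre of `S`. -/
lemma onCircle_toComplex {M : Plane} {R : ℝ} (hR : R ≠ 0) {S : EuclideanGeometry.Sphere Plane}
    (hS : 0 ≤ S.radius) {D X : Plane} :
    OnCircle (2 * toComplex M R S.center - toComplex M R D) (toComplex M R D)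
      ((S.radius ^ 2 - dist D S.center ^ 2) / R ^ 2) (toComplex M R X) ↔ X ∈ S := by
  rw [mem_sphere_iff hS, OnCircle, dist_sq_eq, Complex.ext_iff]
  have e : (((S.radius ^ 2 - ((D 0 - S.center 0) ^ 2 + (D 1 - S.center 1) ^ 2)) / R ^ 2 : ℝ) : ℂ)
      = ⟨(S.radius ^ 2 - ((D 0 - S.center 0) ^ 2 + (D 1 - S.center 1) ^ 2)) / R ^ 2, 0⟩ := rfl
  rw [e]
  simp [toComplex]
  field_simp
  constructor
  · rintro ⟨h, -⟩; linear_combination h / 2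
  · intro h; constructor
    · linear_combination 2 * h
    · ring

lemma mem_line_iff {D A P Q X : Plane} (hA : A ≠ D) (hPQ : P ≠ Q) (hP : P ∈ perpLine D A)
    (hQ : Q ∈ perpLine D A) : X ∈ line[ℝ, P, Q] ↔ X ∈ perpLine D A := by
  refine ⟨fun h => (affineSpan_pair_le_of_mem_of_mem hP hQ) h, fun hX => ?_⟩
  rw [mem_perpLine] at hP hQ hX
  -- Otherwise `X - P` and `Q - P` are independent and both orthogonal to `A - D`, which forces `A =
  -- D`.
  have hc : (X 0 - P 0) * (Q 1 - P 1) = (X 1 - P 1) * (Q 0 - P 0) := by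
    by_contra hne
    have hne := sub_ne_zero.2 hne
    apply hA
    have h0 : A 0 - D 0 = 0 := (mul_eq_zero.1 (show
      ((X 0 - P 0) * (Q 1 - P 1) - (X 1 - P 1) * (Q 0 - P 0)) * (A 0 - D 0) = 0 by
        linear_combination (Q 1 - P 1) * (hX - hP) - (X 1 - P 1) * (hQ - hP))).resolve_left hne
    have h1 : A 1 - D 1 = 0 := (mul_eq_zero.1 (show
      ((X 0 - P 0) * (Q 1 - P 1) - (X 1 - P 1) * (Q 0 - P 0)) * (A 1 - D 1) = 0 by
        linear_combination (X 0 - P 0) * (hQ - hP) - (Q 0 - P 0) * (hX - hP))).resolve_left hne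
    ext i
    fin_cases i
    · exact sub_eq_zero.1 h0
    · exact sub_eq_zero.1 h1
  have hd : (Q 0 - P 0) ^ 2 + (Q 1 - P 1) ^ 2 ≠ 0 := by
    rw [← dist_sq_eq]
    exact pow_ne_zero 2 (dist_ne_zero.2 hPQ.symm)
  have : AffineMap.lineMap P Q (((X 0 - P 0) * (Q 0 - P 0) + (X 1 - P 1) * (Q 1 - P 1)) /
      ((Q 0 - P 0) ^ 2 + (Q 1 - P 1) ^ 2)) = X := by
    ext i
    fin_cases i
    · simp [AffineMap.lineMap_apply]
      field_simp
      linear_combination (-(Q 1 - P 1)) * hc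
    · simp [AffineMap.lineMap_apply]
      field_simp
      linear_combination (Q 0 - P 0) * hc
  rw [← this]
  exact AffineMap.lineMap_mem_affineSpan_pair _ P Q

lemma mem_joinLine_iff {D P X Y : Plane} (hP : P ≠ D) (hX : X ∈ perpLine D P) :
    Y ∈ joinLine D P X ↔ Y ∈ perpLine D P := by
  unfold joinLine
  split_ifs with h
  · rfl
  · exact mem_line_iff hP h (AffineSubspace.self_mem_mk' _ _) hX

lemma affineSpan_triangle_eq_top (T : Affine.Triangle ℝ Plane) :
    affineSpan ℝ (Set.range T.points) = ⊤ :=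
  T.independent.affineSpan_eq_top_iff_card_eq_finrank_add_one.2 (by simp)

lemma circumsphere_eq_of_mem (T : Affine.Triangle ℝ Plane) {S : EuclideanGeometry.Sphere Plane}
    (h : ∀ i, T.points i ∈ S) : T.circumsphere = S := by
  refine (T.circumsphere_unique_dist_eq.2 S ⟨?_, ?_⟩).symm
  · rw [affineSpan_triangle_eq_top]; trivial
  · rintro _ ⟨i, rfl⟩; exact h i

lemma exists_triangle {S : EuclideanGeometry.Sphere Plane} {P Q X : Plane} (hP : P ∈ S)
    (hQ : Q ∈ S) (hX : X ∈ S) (h1 : P ≠ Q) (h2 : P ≠ X) (h3 : Q ≠ X) :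
    ∃ t : Affine.Triangle ℝ Plane, t.points = ![P, Q, X] ∧ t.circumsphere = S := by
  have hind : AffineIndependent ℝ ![P, Q, X] := by
    refine S.cospherical.affineIndependent ?_ ?_
    · rintro _ ⟨i, rfl⟩
      fin_cases i <;> assumption
    · intro i j hij
      fin_cases i <;> fin_cases j <;> simp_all
  refine ⟨⟨_, hind⟩, rfl, circumsphere_eq_of_mem _ fun i => ?_⟩
  fin_cases i <;> assumption

/-! ### Pedal circles, the porism in the plane, and the infertile points -/

/-- The vertices of a triangle are the projections of `D` onto the sides of the negative-pedal
triangle. -/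
lemma IsNegativePedalTriangle.isPedalCircle {D : Plane} {T T' : Affine.Triangle ℝ Plane}
    (h : IsNegativePedalTriangle D T T') (hD : D ∉ T.circumsphere) :
    IsPedalCircle D T' T.circumsphere := by
  refine ⟨T, fun i => Eq.symm ?_, rfl⟩
  have hi : T.points i ≠ D := fun e => hD (e ▸ T.mem_circumsphere i)
  obtain ⟨j, k, hj, hk, hjk, hc⟩ : ∃ j k : Fin 3, j ≠ i ∧ k ≠ i ∧ j ≠ k ∧
      ({i}ᶜ : Set (Fin 3)) = {j, k} := by
    fin_cases i
    · exact ⟨1, 2, by decide, by decide, by decide, by ext x; fin_cases x <;> simp⟩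
    · exact ⟨0, 2, by decide, by decide, by decide, by ext x; fin_cases x <;> simp⟩
    · exact ⟨0, 1, by decide, by decide, by decide, by ext x; fin_cases x <;> simp⟩
  have hs : affineSpan ℝ (Set.range (T'.faceOpposite i).points) = perpLine D (T.points i) := by
    rw [T'.range_faceOpposite_points, hc, Set.image_pair]
    ext X
    exact mem_line_iff hi (fun e => hjk (T'.independent.injective e)) (h i j hj) (h i k hk)
  refine EuclideanGeometry.coe_orthogonalProjection_eq_iff_mem.2 ⟨?_, ?_⟩
  · rw [hs]; exact AffineSubspace.self_mem_mk' _ _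
  · rw [hs, perpLine, AffineSubspace.direction_mk', Submodule.orthogonal_orthogonal,
      Submodule.mem_span_singleton]
    exact ⟨-1, by simp⟩

lemma circumsphere_radius_pos (T : Affine.Triangle ℝ Plane) : 0 < T.circumsphere.radius :=
  T.circumradius_pos

/-- The power of a point off a circle is not zero. -/
lemma power_ne_zero {D : Plane} {T : Affine.Triangle ℝ Plane} (hD : D ∉ T.circumsphere) :
    T.circumsphere.radius ^ 2 - dist D T.circumsphere.center ^ 2 ≠ 0 := by
  intro h
  apply hD
  rw [EuclideanGeometry.mem_sphere, ← sq_eq_sq₀ dist_nonneg (circumsphere_radius_pos T).le]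
  linear_combination -h

theorem porism {D : Plane} {T T' : Affine.Triangle ℝ Plane} (hD : D ∉ T.circumsphere)
    (hT' : IsNegativePedalTriangle D T T') {A B' C' : Plane} (hA : A ∈ T.circumsphere)
    (hne : B' ≠ C') (hB' : B' ∈ perpLine D A) (hB'S : B' ∈ T'.circumsphere)
    (hC' : C' ∈ perpLine D A) (hC'S : C' ∈ T'.circumsphere) :
    ∃ B C A' : Plane,
      (EuclideanGeometry.Sphere.ofDiameter B' D : Set Plane) ∩ T.circumsphere = {A, C} ∧
      (EuclideanGeometry.Sphere.ofDiameter C' D : Set Plane) ∩ T.circumsphere = {A, B} ∧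
      (joinLine D B C' : Set Plane) ∩ joinLine D C B' = {A'} ∧
      A' ∈ T'.circumsphere ∧
      (B ≠ A → C ≠ A → ∃ t : Affine.Triangle ℝ Plane,
        t.points = ![A', B', C'] ∧ t.circumsphere = T'.circumsphere ∧
        IsPedalCircle D t T.circumsphere) := by
  have hR := circumsphere_radius_pos T'
  have hS := (circumsphere_radius_pos T).le
  have hinj := toComplex_injective (M := T'.circumsphere.center) hR.ne'
  have hsurj := toComplex_surjective (M := T'.circumsphere.center) hR.ne'
  have hperp := fun A X => perp_toComplex (M := T'.circumsphere.center) hR.ne' (D := D) (A := A)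
    (X := X)
  have hcirc := fun X => onCircle_toComplex (M := T'.circumsphere.center) hR.ne' hS (D := D)
    (X := X)
  have hunit := fun X => mem_sphere_iff_toComplex hR (X := X)
  have hk : (T.circumsphere.radius ^ 2 - dist D T.circumsphere.center ^ 2)
      / T'.circumsphere.radius ^ 2 ≠ 0 := div_ne_zero (power_ne_zero hD) (pow_ne_zero 2 hR.ne')
  generalize (T.circumsphere.radius ^ 2 - dist D T.circumsphere.center ^ 2)
      / T'.circumsphere.radius ^ 2 = k at hcirc hk
  generalize toComplex T'.circumsphere.center T'.circumsphere.radius = φ at hinj hsurj hperp hcirc hunit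
  generalize 2 * φ T.circumsphere.center - φ D = f at hcirc
  have hT := fun i => (hcirc (T.points i)).2 (T.mem_circumsphere i)
  have hU := fun i => (hunit (T'.points i)).1 (T'.mem_circumsphere i)
  have hP := fun i j hij => (hperp (T.points i) (T'.points j)).2 (hT' i j hij)
  have hn : ∀ i j, i ≠ j → φ (T'.points i) ≠ φ (T'.points j) := fun i j hij e =>
    hij (T'.independent.injective (hinj e))
  -- Apart from its circumcircle, `T'` matters for the porism only through this relation.
  have hK := power_eq_of_triangle hk (hU 0) (hU 1) (hU 2) (hn 0 1 (by decide))
    (hn 0 2 (by decide)) (hn 1 2 (by decide)) (hT 0) (hT 1) (hT 2)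
    (hP 0 1 (by decide)) (hP 0 2 (by decide)) (hP 1 0 (by decide)) (hP 1 2 (by decide))
    (hP 2 0 (by decide)) (hP 2 1 (by decide))
  obtain ⟨w, b, c, hw, hb, hc, hbc, hbv, hbw, hcu, hcw, hu, hv, huniq, hwu, hwv⟩ :=
    porism_unit_circle hk hK ((hunit _).1 hB'S) ((hunit _).1 hC'S) (hinj.ne hne)
      ((hcirc _).2 hA) ((hperp _ _).2 hB') ((hperp _ _).2 hC')
  obtain ⟨A', rfl⟩ := hsurj w
  obtain ⟨B, rfl⟩ := hsurj b
  obtain ⟨C, rfl⟩ := hsurj c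
  -- All complex statements are translated back to the plane.
  simp only [hsurj.forall, hinj.eq_iff, hinj.ne_iff, hcirc, hperp, ← hunit, ne_eq] at *
  have hBD : B ≠ D := fun e => hD (e ▸ hb)
  have hCD : C ≠ D := fun e => hD (e ▸ hc)
  refine ⟨B, C, A', ?_, ?_, ?_, hw, fun hBA hCA => ?_⟩
  · ext X
    simp only [Set.mem_inter_iff, Set.mem_insert_iff, Set.mem_singleton_iff]
    refine ⟨fun h => hu X h.2 (mem_ofDiameter.1 h.1), ?_⟩
    rintro (rfl | rfl)
    exacts [⟨mem_ofDiameter.2 hB', hA⟩, ⟨mem_ofDiameter.2 hcu, hc⟩]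
  · ext X
    simp only [Set.mem_inter_iff, Set.mem_insert_iff, Set.mem_singleton_iff]
    refine ⟨fun h => hv X h.2 (mem_ofDiameter.1 h.1), ?_⟩
    rintro (rfl | rfl)
    exacts [⟨mem_ofDiameter.2 hC', hA⟩, ⟨mem_ofDiameter.2 hbv, hb⟩]
  · ext X
    simp only [Set.mem_inter_iff, SetLike.mem_coe, mem_joinLine_iff hBD hbv,
      mem_joinLine_iff hCD hcu, Set.mem_singleton_iff]
    refine ⟨fun h => huniq X h.1 h.2, ?_⟩
    rintro rfl
    exact ⟨hbw, hcw⟩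
  · obtain ⟨t, ht, htS⟩ := exists_triangle hw hB'S hC'S (hwu hBA) (hwv hCA) hne
    -- `t` is the negative-pedal triangle of `A B C`, so its pedal circle is the circumcircle of `A
    -- B C`.
    obtain ⟨s, hs, hsS⟩ := exists_triangle hA hb hc (Ne.symm hBA) (Ne.symm hCA) hbc
    refine ⟨t, ht, htS, ?_⟩
    rw [← hsS]
    refine IsNegativePedalTriangle.isPedalCircle (fun i j hij => ?_) (hsS ▸ hD)
    rw [ht, hs]
    fin_cases i <;> fin_cases j <;> first | exact absurd rfl hij | assumption

/-- The two vertices of `t'` other than the one opposite to the side through `A` would be distinct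
common points of the perpendicular and the circle. -/
theorem no_triangle {D A : Plane} {S S' : EuclideanGeometry.Sphere Plane}
    (hA : ¬ ((perpLine D A : Set Plane) ∩ S').Nontrivial) :
    ¬ ∃ t t' : Affine.Triangle ℝ Plane, t.circumsphere = S ∧ A ∈ Set.range t.points ∧
      IsNegativePedalTriangle D t t' ∧ t'.circumsphere = S' := by
  rintro ⟨t, t', -, ⟨i, rfl⟩, h, rfl⟩
  obtain ⟨j, k, hj, hk, hjk⟩ : ∃ j k : Fin 3, j ≠ i ∧ k ≠ i ∧ j ≠ k := by
    fin_cases i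
    exacts [⟨1, 2, by decide⟩, ⟨0, 2, by decide⟩, ⟨0, 1, by decide⟩]
  exact hA ⟨t'.points j, ⟨h i j hj, t'.mem_circumsphere j⟩, t'.points k,
    ⟨h i k hk, t'.mem_circumsphere k⟩, fun e => hjk (t'.independent.injective e)⟩

/-! ### The inscribed conic with focus `D` and the infertile arcs -/

/-- A line that does not pass through the focus and has the normal vector `n` is a tangent if and
only if `p n + w` is a unit vector. -/
lemma FocalConic.isTangent_iff {γ : FocalConic} {P Q n : Plane} (hPQ : P ≠ Q)
    (hP : ⟪n, P - γ.focus⟫ = 1) (hQ : ⟪n, Q - γ.focus⟫ = 1) :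
    γ.IsTangent P Q ↔ ‖γ.p • n + γ.w‖ ^ 2 = 1 := by
  rw [inner_eq] at hP hQ
  rw [norm_sq_eq]
  simp only [PiLp.sub_apply, PiLp.add_apply, PiLp.smul_apply, smul_eq_mul] at hP hQ ⊢
  obtain ⟨x, hx⟩ : ∃ x, x = P 0 - γ.focus 0 := ⟨_, rfl⟩
  obtain ⟨y, hy⟩ : ∃ y, y = P 1 - γ.focus 1 := ⟨_, rfl⟩
  obtain ⟨z, hz⟩ : ∃ z, z = Q 0 - γ.focus 0 := ⟨_, rfl⟩
  obtain ⟨u, hu⟩ : ∃ u, u = Q 1 - γ.focus 1 := ⟨_, rfl⟩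
  rw [← hx, ← hy] at hP
  rw [← hz, ← hu] at hQ
  set v₀ := γ.p * n 0 + γ.w 0 with hv₀
  set v₁ := γ.p * n 1 + γ.w 1 with hv₁
  -- On the line `⟪n, X - F⟫ = 1` the constant `p` equals `⟪p n, X - F⟫`, so the equation becomes
  -- the quadratic form `|Y|² - ⟪v, Y⟫²` in `Y = X - F`, with `v = p n + w`.
  have heq : ∀ t : ℝ, γ.eqn (AffineMap.lineMap P Q t) =
      (x + t * (z - x)) ^ 2 + (y + t * (u - y)) ^ 2
        - (v₀ * (x + t * (z - x)) + v₁ * (y + t * (u - y))) ^ 2 := by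
    intro t
    have e : v₀ * (x + t * (z - x)) + v₁ * (y + t * (u - y))
        = γ.p + γ.w 0 * (x + t * (z - x)) + γ.w 1 * (y + t * (u - y)) := by
      linear_combination γ.p * ((1 - t) * hP + t * hQ) + (x + t * (z - x)) * hv₀
        + (y + t * (u - y)) * hv₁
    rw [e, FocalConic.eqn, dist_sq_eq, inner_eq]
    simp [AffineMap.lineMap_apply, hx, hy, hz, hu]
    ring
  have hdet : x * u - y * z ≠ 0 := by
    intro h
    apply hPQ
    have h0 : x = z := by linear_combination z * hP - x * hQ + n 1 * h
    have h1 : y = u := by linear_combination u * hP - y * hQ - n 0 * h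
    ext i
    fin_cases i
    · show P 0 = Q 0
      linarith
    · show P 1 = Q 1
      linarith
  -- The form has determinant `1 - |v|²`, and `x * u - y * z` is the determinant of the two base
  -- points. The values at `0`, `1`, `-1` determine the coefficients.
  have hdisc : ∀ a b c : ℝ, (∀ t : ℝ, γ.eqn (AffineMap.lineMap P Q t) = a * t ^ 2 + b * t + c) →
      discrim a b c = 4 * (x * u - y * z) ^ 2 * (v₀ ^ 2 + v₁ ^ 2 - 1) := by
    intro a b c h
    have h0 := h 0
    have h1 := h 1
    have h2 := h (-1)
    rw [heq] at h0 h1 h2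
    obtain rfl : c = x ^ 2 + y ^ 2 - (v₀ * x + v₁ * y) ^ 2 := by linear_combination -h0
    obtain rfl : b = 2 * (x * (z - x) + y * (u - y)
        - (v₀ * x + v₁ * y) * (v₀ * (z - x) + v₁ * (u - y))) := by
      linear_combination (h2 - h1) / 2
    obtain rfl : a = (z - x) ^ 2 + (u - y) ^ 2 - (v₀ * (z - x) + v₁ * (u - y)) ^ 2 := by
      linear_combination h0 - (h1 + h2) / 2
    rw [discrim]
    ring
  constructor
  · rintro ⟨a, b, c, h, h0⟩
    rw [hdisc a b c h] at h0
    have := (mul_eq_zero.1 h0).resolve_left (by positivity)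
    linarith
  · intro h
    refine ⟨(z - x) ^ 2 + (u - y) ^ 2 - (v₀ * (z - x) + v₁ * (u - y)) ^ 2,
      2 * (x * (z - x) + y * (u - y) - (v₀ * x + v₁ * y) * (v₀ * (z - x) + v₁ * (u - y))),
      x ^ 2 + y ^ 2 - (v₀ * x + v₁ * y) ^ 2, ?_, ?_⟩
    · intro t; rw [heq]; ring
    · rw [hdisc]
      · rw [h]; ring
      · intro t; rw [heq]; ring

/-- A line meets a circle in two points if and only if its distance from the centre is smaller
than the radius. -/
lemma nontrivial_inter_iff {D A : Plane} (hA : A ≠ D) {S : EuclideanGeometry.Sphere Plane}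
    (hS : 0 ≤ S.radius) :
    ((perpLine D A : Set Plane) ∩ S).Nontrivial ↔
      ⟪A - S.center, A - D⟫ ^ 2 < S.radius ^ 2 * ‖A - D‖ ^ 2 := by
  have hpos : 0 < ‖A - D‖ ^ 2 := by
    have := norm_pos_iff.2 (sub_ne_zero.2 hA)
    positivity
  rw [inner_eq]
  rw [norm_sq_eq] at hpos ⊢
  simp only [PiLp.sub_apply] at hpos ⊢
  set x := A 0 - D 0
  set y := A 1 - D 1
  set d := (A 0 - S.center 0) * x + (A 1 - S.center 1) * y with hd
  constructor
  · rintro ⟨P, ⟨hP, hPS⟩, Q, ⟨hQ, hQS⟩, hPQ⟩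
    -- Coordinates along `A - D` and its rotation by a right angle: the first is constant on the
    -- line, and the circle fixes the square of the second.
    have key : ∀ X : Plane, X ∈ perpLine D A → X ∈ S →
        (X 0 - S.center 0) * x + (X 1 - S.center 1) * y = d ∧
        ((X 1 - S.center 1) * x - (X 0 - S.center 0) * y) ^ 2
          = S.radius ^ 2 * (x ^ 2 + y ^ 2) - d ^ 2 := by
      intro X hX hXS
      rw [mem_perpLine] at hX
      rw [mem_sphere_iff hS] at hXS
      have h1 : (X 0 - S.center 0) * x + (X 1 - S.center 1) * y = d := by
        linear_combination hX
      refine ⟨h1, ?_⟩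
      rw [← h1]
      linear_combination (x ^ 2 + y ^ 2) * hXS
    obtain ⟨h1, h2⟩ := key P hP hPS
    obtain ⟨h3, h4⟩ := key Q hQ hQS
    by_contra! hle
    have h5 : (P 1 - S.center 1) * x - (P 0 - S.center 0) * y = 0 :=
      pow_eq_zero_iff two_ne_zero |>.1 (le_antisymm (by linarith) (sq_nonneg _))
    have h6 : (Q 1 - S.center 1) * x - (Q 0 - S.center 0) * y = 0 :=
      pow_eq_zero_iff two_ne_zero |>.1 (le_antisymm (by linarith) (sq_nonneg _))
    have h7 : P 0 = Q 0 :=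
      mul_left_cancel₀ hpos.ne' (by linear_combination x * (h1 - h3) - y * (h5 - h6))
    have h8 : P 1 = Q 1 :=
      mul_left_cancel₀ hpos.ne' (by linear_combination y * (h1 - h3) + x * (h5 - h6))
    apply hPQ
    ext i
    fin_cases i
    exacts [h7, h8]
  · intro h
    set N := x ^ 2 + y ^ 2 with hN
    obtain ⟨e, he, he2⟩ : ∃ e : ℝ, 0 < e ∧ e ^ 2 = S.radius ^ 2 * N - d ^ 2 :=
      ⟨√(S.radius ^ 2 * N - d ^ 2), Real.sqrt_pos.2 (by linarith), Real.sq_sqrt (by linarith)⟩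
    have key : ∀ s : ℝ, s ^ 2 = e ^ 2 →
        (!₂[S.center 0 + (d * x - s * y) / N, S.center 1 + (d * y + s * x) / N] : Plane)
          ∈ (perpLine D A : Set Plane) ∩ S := by
      intro s hs
      have e1 : (d * x - s * y) / N * x + (d * y + s * x) / N * y = d := by
        field_simp; rw [hN]; ring
      have e2 : ((d * x - s * y) / N) ^ 2 + ((d * y + s * x) / N) ^ 2 = S.radius ^ 2 := by
        field_simp; linear_combination N * (hs + he2) - (d ^ 2 + s ^ 2) * hN
      refine ⟨mem_perpLine.2 ?_, (mem_sphere_iff hS).2 ?_⟩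
      · change (S.center 0 + (d * x - s * y) / N - A 0) * x
          + (S.center 1 + (d * y + s * x) / N - A 1) * y = 0
        linear_combination e1 + hd
      · change (S.center 0 + (d * x - s * y) / N - S.center 0) ^ 2
          + (S.center 1 + (d * y + s * x) / N - S.center 1) ^ 2 = S.radius ^ 2
        linear_combination e2
    refine ⟨_, key e rfl, _, key (-e) (by ring), fun h => ?_⟩
    have h0 : S.center 0 + (d * x - e * y) / N = S.center 0 + (d * x - -e * y) / N :=
      congrArg (fun X : Plane => X 0) h
    have h1 : S.center 1 + (d * y + e * x) / N = S.center 1 + (d * y + -e * x) / N :=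
      congrArg (fun X : Plane => X 1) h
    rw [add_right_inj, div_left_inj' hpos.ne'] at h0 h1
    have h2 : e * N = 0 := by linear_combination (x * h1 - y * h0) / 2 + e * hN
    exact (mul_pos he hpos).ne' h2

/-- The conic with focus `D` inscribed in `T` is dual to the circumcircle of the negative-pedal
triangle. -/
lemma isInscribedIn_iff {D : Plane} {T T' : Affine.Triangle ℝ Plane} (hD : D ∉ T.circumsphere)
    (hT' : IsNegativePedalTriangle D T T') {l : ℝ}
    (hl : l = T.circumsphere.radius ^ 2 - dist D T.circumsphere.center ^ 2)
    {γ : FocalConic} (hγ : γ.focus = D) :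
    γ.IsInscribedIn T ↔ γ.p = |l| / T'.circumsphere.radius ∧
      γ.w = (γ.p / l) • ((2 : ℝ) • T.circumsphere.center - D - T'.circumsphere.center) := by
  have hl0 : l ≠ 0 := hl ▸ power_ne_zero hD
  have hR := circumsphere_radius_pos T'
  have hp := γ.p_pos
  set c := (2 : ℝ) • T.circumsphere.center - D with hc
  -- Duality: the normals of the side lines of `T`, seen from `D`, are the vertices of `T'` after a
  -- translation by `-c` and a homothety of ratio `1 / l`.
  have hn : ∀ i j, j ≠ i → ⟪l⁻¹ • (T'.points j - c), T.points i - D⟫ = 1 := by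
    intro i j hij
    have h1 := mem_perpLine.1 (hT' i j hij)
    have h2 := (mem_sphere_iff (circumsphere_radius_pos T).le).1 (T.mem_circumsphere i)
    rw [real_inner_smul_left, inv_mul_eq_one₀ hl0, inner_eq, hl, dist_sq_eq, hc]
    simp only [PiLp.sub_apply, PiLp.smul_apply, smul_eq_mul]
    linear_combination -h1 - h2
  clear_value c
  have hside : γ.IsInscribedIn T ↔ ∀ k, dist (T'.points k) (c - (l / γ.p) • γ.w) = |l| / γ.p := by
    have hk : ∀ i j k : Fin 3, i ≠ j → k ≠ i → k ≠ j → (γ.IsTangent (T.points i) (T.points j) ↔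
        dist (T'.points k) (c - (l / γ.p) • γ.w) = |l| / γ.p) := by
      intro i j k hij hki hkj
      rw [FocalConic.isTangent_iff (fun e => hij (T.independent.injective e))
        (hγ ▸ hn i k hki) (hγ ▸ hn j k hkj), pow_eq_one_iff_of_nonneg (norm_nonneg _) two_ne_zero]
      have e : γ.p • l⁻¹ • (T'.points k - c) + γ.w
          = (γ.p / l) • (T'.points k - (c - (l / γ.p) • γ.w)) := by
        have e1 : γ.p / l * (l / γ.p) = 1 := by field_simp
        rw [← sub_add, smul_add, smul_smul (γ.p / l), e1, one_smul, smul_smul, div_eq_mul_inv]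
      rw [e, norm_smul, Real.norm_eq_abs, abs_div, abs_of_pos hp, dist_eq_norm, eq_div_iff hp.ne',
        div_mul_eq_mul_div, div_eq_one_iff_eq (abs_ne_zero.2 hl0), mul_comm]
    constructor
    · intro h k
      fin_cases k
      · exact (hk 1 2 0 (by decide) (by decide) (by decide)).1 (h 1 2 (by decide))
      · exact (hk 0 2 1 (by decide) (by decide) (by decide)).1 (h 0 2 (by decide))
      · exact (hk 0 1 2 (by decide) (by decide) (by decide)).1 (h 0 1 (by decide))
    · intro h i j hij
      obtain ⟨k, hki, hkj⟩ : ∃ k : Fin 3, k ≠ i ∧ k ≠ j := by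
        revert i j; decide
      exact (hk i j k hij hki hkj).2 (h k)
  rw [hside]
  -- Tangency of the three sides thus says that the vertices of `T'` lie on one circle, which must
  -- be the circumcircle; `p` and `w` are read off from its radius and centre.
  have hcs : (∀ k, dist (T'.points k) (c - (l / γ.p) • γ.w) = |l| / γ.p) ↔
      T'.circumsphere.center = c - (l / γ.p) • γ.w ∧ T'.circumsphere.radius = |l| / γ.p := by
    constructor
    · intro h
      rw [circumsphere_eq_of_mem T' (S := ⟨c - (l / γ.p) • γ.w, |l| / γ.p⟩) h]
      exact ⟨rfl, rfl⟩
    · rintro ⟨h1, h2⟩ k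
      rw [← h1, ← h2]
      exact T'.mem_circumsphere k
  rw [hcs, and_comm]
  refine and_congr ?_ ?_
  · rw [eq_div_iff hp.ne', eq_div_iff hR.ne', mul_comm]
  · have e1 : γ.p / l * (l / γ.p) = 1 := by field_simp
    constructor <;> intro h
    · rw [h, sub_sub_cancel, smul_smul, e1, one_smul]
    · rw [h, smul_smul, mul_comm, e1, one_smul, sub_sub_cancel]

lemma existsUnique_conic {D : Plane} {T T' : Affine.Triangle ℝ Plane} (hD : D ∉ T.circumsphere)
    (hT' : IsNegativePedalTriangle D T T') :
    ∃! γ : FocalConic, γ.focus = D ∧ γ.IsInscribedIn T := by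
  have h := fun γ : FocalConic => isInscribedIn_iff hD hT' rfl (γ := γ)
  have hl := power_ne_zero hD
  generalize T.circumsphere.radius ^ 2 - dist D T.circumsphere.center ^ 2 = l at h hl
  refine ⟨⟨D, (|l| / T'.circumsphere.radius / l) •
    ((2 : ℝ) • T.circumsphere.center - D - T'.circumsphere.center), |l| / T'.circumsphere.radius,
    div_pos (abs_pos.2 hl) (circumsphere_radius_pos T')⟩, ⟨rfl, (h _ rfl).2 ⟨rfl, rfl⟩⟩, ?_⟩
  rintro ⟨F, w, p, hp⟩ ⟨h1, h2⟩
  obtain rfl : F = D := h1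
  obtain ⟨h3, h4⟩ := (h _ rfl).1 h2
  obtain rfl : p = _ := h3
  congr 1

lemma not_nontrivial_iff_mem_conic {D : Plane} {T T' : Affine.Triangle ℝ Plane}
    (hD : D ∉ T.circumsphere) (hT' : IsNegativePedalTriangle D T T') {γ : FocalConic}
    (hγ : γ.focus = D) (h : γ.IsInscribedIn T) {A : Plane} (hA : A ∈ T.circumsphere) :
    ¬ ((perpLine D A : Set Plane) ∩ T'.circumsphere).Nontrivial ↔ A ∈ γ.inside ∪ γ.carrier := by
  have hR := circumsphere_radius_pos T'
  have hAD : A ≠ D := fun e => hD (e ▸ hA)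
  rw [nontrivial_inter_iff hAD hR.le, not_lt]
  obtain ⟨h1, h2⟩ := (isInscribedIn_iff hD hT' rfl hγ).1 h
  have hl := power_ne_zero hD
  have hA' := (mem_sphere_iff (circumsphere_radius_pos T).le).1 hA
  obtain ⟨l, hl'⟩ : ∃ l, l = T.circumsphere.radius ^ 2 - dist D T.circumsphere.center ^ 2 :=
    ⟨_, rfl⟩
  rw [← hl'] at h1 h2 hl
  rw [dist_sq_eq] at hl'
  -- This uses that `A` lies on the circumcircle of `T`. The sign of `l` disappears on squaring, so
  -- `D` may be inside or outside that circle.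
  have e1 : l * (γ.p + ⟪γ.w, A - D⟫) = γ.p * ⟪A - T'.circumsphere.center, A - D⟫ := by
    rw [h2, real_inner_smul_left, inner_eq, inner_eq]
    field_simp
    simp only [PiLp.sub_apply, PiLp.smul_apply, smul_eq_mul]
    linear_combination γ.p * hl' - γ.p * hA'
  have e2 : γ.p ^ 2 * T'.circumsphere.radius ^ 2 = l ^ 2 := by
    rw [h1, ← sq_abs l]; field_simp
  -- Up to a positive factor, the equation of the conic at `A` is the quantity whose sign
  -- `nontrivial_inter_iff` tests.
  have e3 : T'.circumsphere.radius ^ 2 * γ.eqn A =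
      T'.circumsphere.radius ^ 2 * ‖A - D‖ ^ 2 - ⟪A - T'.circumsphere.center, A - D⟫ ^ 2 := by
    rw [FocalConic.eqn, hγ, dist_eq_norm]
    refine mul_left_cancel₀ (pow_ne_zero 2 hl) ?_
    linear_combination
      (-T'.circumsphere.radius ^ 2) * (l * (γ.p + ⟪γ.w, A - D⟫)
        + γ.p * ⟪A - T'.circumsphere.center, A - D⟫) * e1
        - ⟪A - T'.circumsphere.center, A - D⟫ ^ 2 * e2
  have hR2 : 0 < T'.circumsphere.radius ^ 2 := by positivity
  have : A ∈ γ.inside ∪ γ.carrier ↔ γ.eqn A ≤ 0 :=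
    (le_iff_lt_or_eq (a := γ.eqn A)).symm
  rw [this, ← sub_nonpos, ← e3, mul_nonpos_iff_pos_imp_nonpos]
  exact ⟨fun h => h.1 hR2, fun h => ⟨fun _ => h, fun _ => hR2.le⟩⟩

end PedalPorism

theorem mainTheorem3 (T : Affine.Triangle ℝ PedalPorism.Plane) (D : PedalPorism.Plane)
    (hDside : ∀ i j, i ≠ j → D ∉ line[ℝ, T.points i, T.points j])
    (hDcirc : D ∉ T.circumsphere)
    (T' : Affine.Triangle ℝ PedalPorism.Plane)
    (hT' : PedalPorism.IsNegativePedalTriangle D T T') :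
    -- the porism
    (∀ A ∈ T.circumsphere, ∀ B' C' : PedalPorism.Plane, B' ≠ C' →
      B' ∈ PedalPorism.perpLine D A → B' ∈ T'.circumsphere →
      C' ∈ PedalPorism.perpLine D A → C' ∈ T'.circumsphere →
      ∃ B C A' : PedalPorism.Plane,
        -- `A, C` and `A, B` are the intersections, counted with multiplicity
        (EuclideanGeometry.Sphere.ofDiameter B' D : Set PedalPorism.Plane) ∩ T.circumsphere
          = {A, C} ∧
        (EuclideanGeometry.Sphere.ofDiameter C' D : Set PedalPorism.Plane) ∩ T.circumsphere
          = {A, B} ∧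
        (PedalPorism.joinLine D B C' : Set PedalPorism.Plane) ∩ PedalPorism.joinLine D C B'
          = {A'} ∧
        A' ∈ T'.circumsphere ∧
        (B ≠ A → C ≠ A → ∃ t : Affine.Triangle ℝ PedalPorism.Plane,
          t.points = ![A', B', C'] ∧ t.circumsphere = T'.circumsphere ∧
          PedalPorism.IsPedalCircle D t T.circumsphere)) ∧
    -- `C` is the pedal circle of the negative-pedal triangle of `T`
    PedalPorism.IsPedalCircle D T' T.circumsphere ∧
    -- when the perpendicular at `A` does not meet the negative-pedal circle in two points,
    -- no triangle with a vertex in `A` exists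
    (∀ A ∈ T.circumsphere,
      ¬ ((PedalPorism.perpLine D A : Set PedalPorism.Plane) ∩ T'.circumsphere).Nontrivial →
      ¬ ∃ t t' : Affine.Triangle ℝ PedalPorism.Plane,
        t.circumsphere = T.circumsphere ∧ A ∈ Set.range t.points ∧
        PedalPorism.IsNegativePedalTriangle D t t' ∧ t'.circumsphere = T'.circumsphere) ∧
    -- and this occurs exactly inside or on the conic inscribed in `T` with focus `D`
    (∃! γ : PedalPorism.FocalConic, γ.focus = D ∧ γ.IsInscribedIn T) ∧
    (∀ γ : PedalPorism.FocalConic, γ.focus = D → γ.IsInscribedIn T →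
      ∀ A ∈ T.circumsphere,
        (¬ ((PedalPorism.perpLine D A : Set PedalPorism.Plane) ∩ T'.circumsphere).Nontrivial ↔
          A ∈ γ.inside ∪ γ.carrier)) :=
  ⟨fun _ hA _ _ hne hB' hB'S hC' hC'S =>
      PedalPorism.porism hDcirc hT' hA hne hB' hB'S hC' hC'S,
    hT'.isPedalCircle hDcirc, fun _ _ h => PedalPorism.no_triangle h,
    PedalPorism.existsUnique_conic hDcirc hT',
    fun _ hγ h _ hA => PedalPorism.not_nontrivial_iff_mem_conic hDcirc hT' hγ h hA⟩
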